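/- Let $n\ge 1$, let $H=(\mathbb{C}^2)^{\otimes n}$ be the $n$-qubit Hilbert space, and let $G=U(1)\times SU(2)^n$ be the local unitary group, acting on $H$ by $\Phi\big((u,U_1,\dots,U_n),\psi\big)=u\,(U_1\otimes\cdots\otimes U_n)\psi$. Let $\mathfrak g=u(1)\oplus su(2)^{\oplus n}$ be its real Lie algebra. For $\psi\in H$ let $\Phi_\psi\colon G\to H$, $g\mapsto\Phi(g,\psi)$, let $d\Phi_\psi\colon\mathfrak g\to T_\psi H\cong H$ be its derivative at the identity, and let $K_\psi=\ker d\Phi_\psi\subseteq\mathfrak g$ be the (local unitary) stabilizer subalgebra of $\psi$. **Corollary (Nonproduct maximum stabilizer dimension).** Let $\psi\in H$, $\psi\neq 0$, be an $n$-qubit state vector that does not factor as a product of an $m$-qubit state vector and an $(n-m)$-qubit state vector for any choice of $m$ of the $n$ qubits, $1\le m<n$; that is, for no nonempty proper subset $S\subset\{1,\dots,n\}$ is $\psi$ the tensor product of a vector in the state space of the qubits in $S$ and a vector in the state space of the remaining qubits. Then $$ \dim_{\mathbb R} K_\psi\ \le\ \begin{cases}1, & n=1,\\ 3, & n=2,\\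 n-1, & n\ge 3.\end{cases} $$ -/

import Mathlib

open scoped Matrix

noncomputable section

/- The Lie bracket of matrices is the commutator. -/
attribute [local instance] LieRing.ofAssociativeRing

namespace QubitStab

/-- The Hilbert space `(ℂ²)^{⊗ι}` of a register of qubits labelled by the finite set `ι`, in the
computational basis `|I⟩`, `I : ι → {0, 1}`; for `ι = Fin n` this is the `n`-qubit space. -/
abbrev QubitSpace (ι : Type) [Fintype ι] : Type := EuclideanSpace ℂ (ι → Fin 2)

/-- The local unitary group `U(1) × SU(2)^n`. -/
abbrev LocalUnitary (n : ℕ) : Type :=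
  Circle × (Fin n → Matrix.specialUnitaryGroup (Fin 2) ℂ)

/-- The real Lie algebra `su(2)` of traceless skew-Hermitian `2 × 2` matrices. -/
def su2 : LieSubalgebra ℝ (Matrix (Fin 2) (Fin 2) ℂ) where
  carrier := {X | Xᴴ = -X ∧ X.trace = 0}
  add_mem' := by
    rintro X Y ⟨hX, hX'⟩ ⟨hY, hY'⟩
    refine ⟨?_, ?_⟩
    · rw [Matrix.conjTranspose_add, hX, hY]; abel
    · rw [Matrix.trace_add, hX', hY', add_zero]
  zero_mem' := by simp
  smul_mem' := by
    rintro c X ⟨hX, hX'⟩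
    refine ⟨?_, ?_⟩
    · rw [Matrix.conjTranspose_smul, hX]; simp
    · rw [Matrix.trace_smul, hX', smul_zero]
  lie_mem' := by
    rintro X Y ⟨hX, hX'⟩ ⟨hY, hY'⟩
    refine ⟨?_, ?_⟩
    · rw [Ring.lie_def, Matrix.conjTranspose_sub, Matrix.conjTranspose_mul,
        Matrix.conjTranspose_mul, hX, hY]
      simp
    · rw [Ring.lie_def, Matrix.trace_sub, Matrix.trace_mul_comm, sub_self]

/-- The Lie bracket of `su(2)^n` is taken slot by slot. -/
instance su2PiLieRing (n : ℕ) : LieRing (Fin n → su2) where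
  bracket X Y := fun j => ⁅X j, Y j⁆
  add_lie X Y Z := funext fun j => add_lie (X j) (Y j) (Z j)
  lie_add X Y Z := funext fun j => lie_add (X j) (Y j) (Z j)
  lie_self X := funext fun j => lie_self (X j)
  leibniz_lie X Y Z := funext fun j => leibniz_lie (X j) (Y j) (Z j)

instance su2PiLieAlgebra (n : ℕ) : LieAlgebra ℝ (Fin n → su2) where
  lie_smul c X Y := funext fun j => lie_smul c (X j) (Y j)

/-- The local unitary Lie algebra `𝔤 = 𝔤₀ ⊕ 𝔤₁ ⊕ ⋯ ⊕ 𝔤ₙ`, where `𝔤₀ = u(1) = iℝ` is identified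
with `ℝ` (the number `θ` standing for `iθ`) and `𝔤ⱼ = su(2)` for each qubit `j`. -/
abbrev LocalLie (n : ℕ) : Type := ℝ × (Fin n → su2)

/-- The action `Φ : G × H → H`: the element `(u, (U₁, …, Uₙ))` acts as
`u · U₁ ⊗ ⋯ ⊗ Uₙ`, whose matrix entries in the computational basis are
`u · ∏ⱼ (Uⱼ)_{Iⱼ Jⱼ}`. -/
def Phi {n : ℕ} (g : LocalUnitary n) (ψ : QubitSpace (Fin n)) : QubitSpace (Fin n) :=
  WithLp.toLp 2 fun I => (g.1 : ℂ) * ∑ J : Fin n → Fin 2,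
    (∏ j, (g.2 j : Matrix (Fin 2) (Fin 2) ℂ) (I j) (J j)) * ψ J

theorem exp_mem_SU2 (X : su2) :
    NormedSpace.exp (X : Matrix (Fin 2) (Fin 2) ℂ) ∈ Matrix.specialUnitaryGroup (Fin 2) ℂ := by
  obtain ⟨X, hX, hX'⟩ := X
  simp only
  have hinv : NormedSpace.exp X * NormedSpace.exp (-X) = 1 := by
    rw [← Matrix.exp_add_of_commute _ _ (Commute.neg_right (Commute.refl X)), add_neg_cancel,
      NormedSpace.exp_zero]
  rw [Matrix.mem_specialUnitaryGroup_iff]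
  refine ⟨?_, ?_⟩
  · rw [Matrix.mem_unitaryGroup_iff, Matrix.star_eq_conjTranspose, ← Matrix.exp_conjTranspose, hX,
      hinv]
  · -- `J Xᵀ J⁻¹ = -X` for traceless `X`, and `M J Mᵀ = det M • J` for all `M`
    set J : Matrix (Fin 2) (Fin 2) ℂ := !![0, 1; -1, 0] with hJ
    have hJdet : IsUnit J := by
      rw [Matrix.isUnit_iff_isUnit_det]; simp [hJ, Matrix.det_fin_two]
    have hJJ : J⁻¹ * J = 1 := Matrix.nonsing_inv_mul _ ((Matrix.isUnit_iff_isUnit_det _).1 hJdet)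
    have hJJ' : J * J⁻¹ = 1 := Matrix.mul_nonsing_inv _ ((Matrix.isUnit_iff_isUnit_det _).1 hJdet)
    have h1 : J * Xᵀ = -X * J := by
      rw [Matrix.trace_fin_two] at hX'
      have h11 : X 1 1 = - X 0 0 := by linear_combination hX'
      ext i j
      fin_cases i <;> fin_cases j <;> simp [hJ, Matrix.mul_apply, Fin.sum_univ_two, h11]
    have h2 : J * Xᵀ * J⁻¹ = -X := by rw [h1, mul_assoc, hJJ', mul_one]
    have h3 : J * (NormedSpace.exp X)ᵀ = NormedSpace.exp (-X) * J := by
      rw [← h2, Matrix.exp_conj _ _ hJdet, ← Matrix.exp_transpose, mul_assoc, hJJ, mul_one]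
    have h4 : NormedSpace.exp X * (J * (NormedSpace.exp X)ᵀ) = J := by
      rw [h3, ← mul_assoc, hinv, one_mul]
    have h5 := congrFun (congrFun h4 0) 1
    generalize NormedSpace.exp X = M at h5
    rw [Matrix.det_fin_two]
    simp [hJ, Matrix.mul_apply, Matrix.vecMul, dotProduct, Fin.sum_univ_two] at h5
    linear_combination h5

/-- The exponential map `𝔤 → G` of the local unitary group. -/
def expLU {n : ℕ} (X : LocalLie n) : LocalUnitary n :=
  (Circle.exp X.1, fun j => ⟨NormedSpace.exp (X.2 j : Matrix (Fin 2) (Fin 2) ℂ), exp_mem_SU2 _⟩)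

/-- The derivative at the identity `dΦ_ψ : 𝔤 → T_ψ H = H` of the orbit map `Φ_ψ : g ↦ Φ(g, ψ)`,
computed along the one-parameter subgroups `t ↦ exp (t X)`. -/
def dPhi {n : ℕ} (ψ : QubitSpace (Fin n)) (X : LocalLie n) : QubitSpace (Fin n) :=
  deriv (fun t : ℝ => Phi (expLU (t • X)) ψ) 0

/-- The operator that applies the matrix `M` to qubit `j` and the identity to all other qubits. -/
def siteOp {n : ℕ} (j : Fin n) (M : Matrix (Fin 2) (Fin 2) ℂ) :
    ((Fin n → Fin 2) → ℂ) →ₗ[ℂ] ((Fin n → Fin 2) → ℂ) where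
  toFun v I := ∑ a, M (I j) a * v (Function.update I j a)
  map_add' v w := by ext I; simp [mul_add, Finset.sum_add_distrib]
  map_smul' c v := by ext I; simp [mul_left_comm, mul_add]

theorem siteOp_add {n : ℕ} (j : Fin n) (M N : Matrix (Fin 2) (Fin 2) ℂ) :
    siteOp j (M + N) = siteOp j M + siteOp j N := by
  refine LinearMap.ext fun v => funext fun I => ?_
  simp [siteOp, add_mul]; ring

theorem siteOp_smul {n : ℕ} (j : Fin n) (c : ℝ) (M : Matrix (Fin 2) (Fin 2) ℂ) :
    siteOp j (c • M) = (c : ℂ) • siteOp j M := by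
  refine LinearMap.ext fun v => funext fun I => ?_
  simp [siteOp, mul_assoc, mul_add]

theorem siteOp_sub {n : ℕ} (j : Fin n) (M N : Matrix (Fin 2) (Fin 2) ℂ) :
    siteOp j (M - N) = siteOp j M - siteOp j N := by
  refine LinearMap.ext fun v => funext fun I => ?_
  simp [siteOp, sub_mul]

theorem siteOp_mul {n : ℕ} (j : Fin n) (M N : Matrix (Fin 2) (Fin 2) ℂ) :
    siteOp j (M * N) = siteOp j M * siteOp j N := by
  refine LinearMap.ext fun v => funext fun I => ?_
  simp [siteOp, Matrix.mul_apply]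
  ring

theorem siteOp_comm {n : ℕ} {j k : Fin n} (h : j ≠ k) (M N : Matrix (Fin 2) (Fin 2) ℂ) :
    siteOp j M * siteOp k N = siteOp k N * siteOp j M := by
  refine LinearMap.ext fun v => funext fun I => ?_
  simp only [siteOp, Module.End.mul_apply, LinearMap.coe_mk, AddHom.coe_mk,
    Function.update_of_ne h, Function.update_of_ne h.symm, Finset.mul_sum]
  rw [Finset.sum_comm]
  refine Finset.sum_congr rfl fun a _ => Finset.sum_congr rfl fun b _ => ?_
  rw [Function.update_comm h]
  ring

/-- The infinitesimal action of `𝔤` on the coordinates of a state vector: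
`(θ, X₁, …, Xₙ)` acts as `iθ + ∑ⱼ (Xⱼ)_j`. -/
def infAct {n : ℕ} (X : LocalLie n) : Module.End ℂ ((Fin n → Fin 2) → ℂ) :=
  ((X.1 : ℂ) * Complex.I) • 1 + ∑ j, siteOp j (X.2 j : Matrix (Fin 2) (Fin 2) ℂ)

theorem infAct_add {n : ℕ} (X Y : LocalLie n) : infAct (X + Y) = infAct X + infAct Y := by
  simp only [infAct, Prod.fst_add, Prod.snd_add, Pi.add_apply, AddMemClass.coe_add, siteOp_add,
    Finset.sum_add_distrib, Complex.ofReal_add, add_mul, add_smul]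
  abel

theorem infAct_smul {n : ℕ} (c : ℝ) (X : LocalLie n) : infAct (c • X) = (c : ℂ) • infAct X := by
  simp only [infAct, Prod.smul_fst, Prod.smul_snd, Pi.smul_apply, SetLike.val_smul,
    siteOp_smul, smul_add, Finset.smul_sum, smul_eq_mul, Complex.ofReal_mul, smul_smul, mul_assoc]

theorem infAct_lie {n : ℕ} (X Y : LocalLie n) :
    infAct ⁅X, Y⁆ = infAct X * infAct Y - infAct Y * infAct X := by
  have key : ∀ A B : Fin n → Module.End ℂ ((Fin n → Fin 2) → ℂ),
      (∀ j k, j ≠ k → A j * B k = B k * A j) →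
      (∑ j, A j) * (∑ j, B j) - (∑ j, B j) * (∑ j, A j) = ∑ j, (A j * B j - B j * A j) := by
    intro A B h
    rw [Finset.sum_mul_sum, Finset.sum_mul_sum, Finset.sum_comm (f := fun i j => B i * A j),
      ← Finset.sum_sub_distrib]
    refine Finset.sum_congr rfl fun j _ => ?_
    rw [← Finset.sum_sub_distrib, Finset.sum_eq_single j]
    · intro k _ hk
      rw [h j k hk.symm, sub_self]
    · simp
  have h := key (fun j => siteOp j (X.2 j : Matrix (Fin 2) (Fin 2) ℂ))
    (fun j => siteOp j (Y.2 j : Matrix (Fin 2) (Fin 2) ℂ)) (fun j k hjk => siteOp_comm hjk _ _)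
  have h0 : (⁅X, Y⁆ : LocalLie n).1 = 0 := by
    change ⁅X.1, Y.1⁆ = 0
    rw [Ring.lie_def, mul_comm, sub_self]
  have h2 : ∀ j, (((⁅X, Y⁆ : LocalLie n).2 j : su2) : Matrix (Fin 2) (Fin 2) ℂ)
      = (X.2 j : Matrix (Fin 2) (Fin 2) ℂ) * Y.2 j - Y.2 j * X.2 j := fun j => rfl
  simp only [← siteOp_mul, ← siteOp_sub, ← h2] at h
  simp only [infAct, h0]
  rw [← h]
  simp only [add_mul, mul_add, smul_mul_assoc, mul_smul_comm, one_mul, mul_one, Complex.ofReal_zero,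
    zero_mul, zero_smul, zero_add]
  simp only [smul_add, smul_smul, mul_comm ((Y.1 : ℂ) * Complex.I)]
  abel

theorem hasDerivAt_matrix_exp (X : Matrix (Fin 2) (Fin 2) ℂ) (a b : Fin 2) :
    HasDerivAt (fun t : ℝ => NormedSpace.exp (t • X) a b) (X a b) 0 := by
  let _ : NormedRing (Matrix (Fin 2) (Fin 2) ℂ) := Matrix.linftyOpNormedRing
  let _ : NormedAlgebra ℝ (Matrix (Fin 2) (Fin 2) ℂ) := Matrix.linftyOpNormedAlgebra
  have h := hasDerivAt_exp_smul_const (𝕂 := ℝ) X 0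
  rw [zero_smul, NormedSpace.exp_zero, one_mul] at h
  exact hasDerivAt_pi.1 (hasDerivAt_pi.1 h a) b

theorem hasDerivAt_Phi {n : ℕ} (ψ : QubitSpace (Fin n)) (X : LocalLie n) :
    HasDerivAt (fun t : ℝ => Phi (expLU (t • X)) ψ) (WithLp.toLp 2 (infAct X ψ.ofLp)) 0 := by
  have hcirc : HasDerivAt (fun t : ℝ => ((Circle.exp (t * X.1) : Circle) : ℂ))
      ((X.1 : ℂ) * Complex.I) 0 := by
    have h : HasDerivAt (fun t : ℝ => ((t : ℂ) * ((X.1 : ℂ) * Complex.I)))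
        ((X.1 : ℂ) * Complex.I) 0 := by
      simpa using (Complex.ofRealCLM.hasDerivAt (x := (0 : ℝ))).mul_const ((X.1 : ℂ) * Complex.I)
    have h' := h.cexp
    simpa [Circle.coe_exp, mul_assoc] using h'
  have hprod : ∀ I J : Fin n → Fin 2, HasDerivAt
      (fun t : ℝ => ∏ j, NormedSpace.exp (t • (X.2 j : Matrix (Fin 2) (Fin 2) ℂ)) (I j) (J j))
      (∑ j, (∏ k ∈ Finset.univ.erase j, (1 : Matrix (Fin 2) (Fin 2) ℂ) (I k) (J k)) *
        (X.2 j : Matrix (Fin 2) (Fin 2) ℂ) (I j) (J j)) 0 := by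
    intro I J
    have h := HasDerivAt.fun_finsetProd (u := Finset.univ) (x := (0 : ℝ))
      (f := fun j t => NormedSpace.exp (t • (X.2 j : Matrix (Fin 2) (Fin 2) ℂ)) (I j) (J j))
      (fun j _ => hasDerivAt_matrix_exp (X.2 j : Matrix (Fin 2) (Fin 2) ℂ) (I j) (J j))
    simpa only [zero_smul, NormedSpace.exp_zero, smul_eq_mul] using h
  have hone : ∀ I J : Fin n → Fin 2,
      (∏ j, (1 : Matrix (Fin 2) (Fin 2) ℂ) (I j) (J j)) = if I = J then 1 else 0 := by
    intro I J
    split_ifs with h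
    · subst h
      exact Finset.prod_eq_one fun k _ => Matrix.one_apply_eq _
    · obtain ⟨k, hk⟩ := Function.ne_iff.1 h
      exact Finset.prod_eq_zero (Finset.mem_univ k) (Matrix.one_apply_ne hk)
  have hsite : ∀ (I : Fin n → Fin 2) (j : Fin n),
      ∑ a, (X.2 j : Matrix (Fin 2) (Fin 2) ℂ) (I j) a * ψ (Function.update I j a) =
      ∑ J : Fin n → Fin 2, (∏ k ∈ Finset.univ.erase j,
        (1 : Matrix (Fin 2) (Fin 2) ℂ) (I k) (J k)) *
        (X.2 j : Matrix (Fin 2) (Fin 2) ℂ) (I j) (J j) * ψ J := by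
    intro I j
    refine Finset.sum_of_injOn (fun a => Function.update I j a)
      (fun a _ b _ h => Function.update_injective I j h) (fun _ _ => Finset.mem_coe.2
        (Finset.mem_univ _)) ?_ ?_
    · intro J _ hJ
      have : ∃ k, k ≠ j ∧ I k ≠ J k := by
        by_contra! hcon
        refine hJ ⟨J j, Finset.mem_coe.2 (Finset.mem_univ _), funext fun k => ?_⟩
        by_cases hk : k = j
        · subst hk; simp
        · simp [Function.update_of_ne hk, hcon k hk]
      obtain ⟨k, hkj, hk⟩ := this
      have h0 : (∏ k ∈ Finset.univ.erase j,
          (1 : Matrix (Fin 2) (Fin 2) ℂ) (I k) (J k)) = 0 :=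
        Finset.prod_eq_zero (Finset.mem_erase.2 ⟨hkj, Finset.mem_univ k⟩) (Matrix.one_apply_ne hk)
      rw [h0, zero_mul, zero_mul]
    · intro a _
      have : (∏ k ∈ Finset.univ.erase j,
          (1 : Matrix (Fin 2) (Fin 2) ℂ) (I k) (Function.update I j a k)) = 1 := by
        refine Finset.prod_eq_one fun k hk => ?_
        rw [Function.update_of_ne (Finset.ne_of_mem_erase hk), Matrix.one_apply_eq]
      simp [this]
  have hcoord : HasDerivAt (fun t : ℝ => (Phi (expLU (t • X)) ψ).ofLp) (infAct X ψ.ofLp) 0 := by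
    refine hasDerivAt_pi.2 fun I => ?_
    have h := hcirc.mul (HasDerivAt.fun_sum (u := Finset.univ)
      (fun J _ => (hprod I J).mul_const (ψ J)))
    refine h.congr_deriv ?_
    simp only [zero_mul, zero_smul, NormedSpace.exp_zero, hone, Circle.exp_zero, Circle.coe_one,
      one_mul, ite_mul, Finset.sum_ite_eq, Finset.mem_univ, if_true, infAct, LinearMap.add_apply,
      LinearMap.smul_apply, Module.End.one_apply, Pi.add_apply, Pi.smul_apply, smul_eq_mul,
      LinearMap.sum_apply, Finset.sum_apply, siteOp, LinearMap.coe_mk, AddHom.coe_mk, hsite,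
      Finset.sum_mul]
    rw [Finset.sum_comm]
  exact (PiLp.continuousLinearEquiv 2 ℝ (fun _ : Fin n → Fin 2 => ℂ)).symm.hasFDerivAt
    |>.comp_hasDerivAt (0 : ℝ) hcoord

theorem dPhi_eq {n : ℕ} (ψ : QubitSpace (Fin n)) (X : LocalLie n) :
    dPhi ψ X = WithLp.toLp 2 (infAct X ψ.ofLp) :=
  (hasDerivAt_Phi ψ X).deriv

/-- The stabilizer subalgebra `K_ψ = ker dΦ_ψ ⊆ 𝔤`. -/
def stabilizer {n : ℕ} (ψ : QubitSpace (Fin n)) : LieSubalgebra ℝ (LocalLie n) where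
  carrier := {X | dPhi ψ X = 0}
  add_mem' := by
    intro X Y hX hY
    simp only [Set.mem_ofPred_eq, dPhi_eq, WithLp.toLp_eq_zero] at *
    rw [infAct_add, LinearMap.add_apply, hX, hY, add_zero]
  zero_mem' := by
    have h := infAct_smul (n := n) 0 0
    simp only [Set.mem_ofPred_eq, dPhi_eq, WithLp.toLp_eq_zero]
    rw [smul_zero] at h
    rw [h]; simp
  smul_mem' := by
    intro c X hX
    simp only [Set.mem_ofPred_eq, dPhi_eq, WithLp.toLp_eq_zero] at *
    rw [infAct_smul, LinearMap.smul_apply, hX, smul_zero]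
  lie_mem' := by
    intro X Y hX hY
    simp only [Set.mem_ofPred_eq, dPhi_eq, WithLp.toLp_eq_zero] at *
    rw [infAct_lie, LinearMap.sub_apply, Module.End.mul_apply, Module.End.mul_apply, hX, hY,
      map_zero, map_zero, sub_zero]

/-- `ψ` is, up to the ordering of the tensor factors, the product `φ ⊗ χ` of a state `φ` of the
qubits in some set `S` and a state `χ` of the remaining qubits, with `S` neither empty nor the
set of all qubits. -/
def IsProduct {n : ℕ} (ψ : QubitSpace (Fin n)) : Prop :=
  ∃ S : Finset (Fin n), S.Nonempty ∧ Sᶜ.Nonempty ∧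
    ∃ (φ : QubitSpace {j // j ∈ S}) (χ : QubitSpace {j // j ∉ S}),
      ∀ I : Fin n → Fin 2, ψ I = φ (fun j => I j) * χ (fun j => I j)

end QubitStab

end

open scoped Matrix

noncomputable section

attribute [local instance] LieRing.ofAssociativeRing

open scoped ComplexOrder

namespace QubitStab

/-! Let `K` be the stabilizer algebra. Each projection of `K` to a qubit has as image a Lie
subalgebra of su(2), so its rank is 0, 1 or 3. Let `S` be the set of qubits of rank 3, partitioned
into blocks according to the kernel of the projection. Since su(2) is simple, a Goursat-type
argument (`exists_supported_on_block`) finds in `K`, for each block, phase-free elements supported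
on that block with arbitrary component at a chosen qubit of it.

Such elements annihilate ψ, and for n ≥ 3 this forces every block to have at least four qubits
(`four_le_card_block`). A block of one is impossible because a nonzero element of su(2) is
invertible. A block of two puts its pair of qubits in a tensor factor by Schur's lemma. In a block
of three, some element acts as a sum of three commuting square roots of -1, and such a sum has
eigenvalues ±i, ±3i, never 0.

An element of `K` is determined by its components at one representative per block and at the qubits
outside `S`. With r blocks this gives dim K ≤ 3r + |Sᶜ|, where 4r ≤ |S|. If `S` is everything, 3r ≤
n - 1 already. Otherwise equality would yield a nonzero element of `K` acting on a single qubit,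
which a nonproduct state excludes (`eq_zero_of_supported_on_site`). -/

/-! ### The algebra su(2) as ℝ³ with twice the cross product -/

/-- Coordinates on `su(2)` in the basis `iσ_z, iσ_y, iσ_x`. -/
def su2Equiv : su2 ≃ₗ[ℝ] (Fin 3 → ℝ) where
  toFun X := ![(X.1 0 0).im, (X.1 0 1).re, (X.1 0 1).im]
  map_add' X Y := by ext i; fin_cases i <;> simp
  map_smul' c X := by ext i; fin_cases i <;> simp
  invFun v := ⟨!![⟨0, v 0⟩, ⟨v 1, v 2⟩; ⟨-v 1, v 2⟩, ⟨0, -v 0⟩], by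
    refine ⟨?_, ?_⟩
    · ext i j
      fin_cases i <;> fin_cases j <;> simp [Complex.ext_iff]
    · simp [Matrix.trace_fin_two, Complex.ext_iff]⟩
  left_inv := by
    rintro ⟨X, hX, hX'⟩
    have h00 := congrFun (congrFun hX 0) 0
    have h01 := congrFun (congrFun hX 0) 1
    rw [Matrix.trace_fin_two] at hX'
    simp [Complex.ext_iff] at h00 h01 hX'
    refine Subtype.ext ?_
    ext i j
    fin_cases i <;> fin_cases j <;> simp [Complex.ext_iff] <;> (try constructor) <;> linarith
  right_inv v := by ext i; fin_cases i <;> simp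

theorem coe_su2Equiv_symm (v : Fin 3 → ℝ) : (su2Equiv.symm v : Matrix (Fin 2) (Fin 2) ℂ) =
    !![⟨0, v 0⟩, ⟨v 1, v 2⟩; ⟨-v 1, v 2⟩, ⟨0, -v 0⟩] := rfl

theorem su2_lie_symm (u v : Fin 3 → ℝ) :
    ⁅su2Equiv.symm u, su2Equiv.symm v⁆ = su2Equiv.symm ((2 : ℝ) • (u ⨯₃ v)) := by
  refine Subtype.ext ?_
  rw [LieSubalgebra.coe_bracket, Ring.lie_def]
  simp only [coe_su2Equiv_symm]
  ext i j
  fin_cases i <;> fin_cases j <;>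
    simp [Complex.ext_iff, cross_apply] <;>
    (try constructor) <;> ring

theorem su2Equiv_lie (X Y : su2) :
    su2Equiv ⁅X, Y⁆ = (2 : ℝ) • (su2Equiv X ⨯₃ su2Equiv Y) := by
  have h := su2_lie_symm (su2Equiv X) (su2Equiv Y)
  simp only [LinearEquiv.symm_apply_apply] at h
  rw [h, LinearEquiv.apply_symm_apply]

theorem su2_mul_self (X : su2) :
    (X : Matrix (Fin 2) (Fin 2) ℂ) * X = (-(su2Equiv X ⬝ᵥ su2Equiv X)) • 1 := by
  obtain ⟨v, rfl⟩ := su2Equiv.symm.surjective X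
  simp only [LinearEquiv.apply_symm_apply, coe_su2Equiv_symm]
  ext i j
  fin_cases i <;> fin_cases j <;>
    simp [Matrix.mul_apply, Fin.sum_univ_two, Complex.ext_iff, dotProduct, Fin.sum_univ_three] <;>
    (try constructor) <;> ring

theorem dotProduct_self_ne_zero {v : Fin 3 → ℝ} (hv : v ≠ 0) : v ⬝ᵥ v ≠ 0 := by
  rwa [Ne, dotProduct_self_eq_zero]

theorem cross_cross_self_eq (u v : Fin 3 → ℝ) :
    u ⨯₃ (u ⨯₃ v) = (u ⬝ᵥ v) • u - (u ⬝ᵥ u) • v := by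
  ext i
  fin_cases i <;> simp [cross_apply, dotProduct, Fin.sum_univ_three] <;> ring

/-- `su(2)` is a simple Lie algebra. -/
theorem su2_ideal_eq_top {W : Submodule ℝ su2} (hW : ∀ X : su2, ∀ Y ∈ W, ⁅X, Y⁆ ∈ W) (hne : W ≠ ⊥) :
    W = ⊤ := by
  obtain ⟨U, hU, hU0⟩ := Submodule.exists_mem_ne_zero_of_ne_bot hne
  have hu : su2Equiv U ⬝ᵥ su2Equiv U ≠ 0 := dotProduct_self_ne_zero (by simpa using hU0)
  refine eq_top_iff.2 fun X _ => ?_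
  have h1 : ⁅U, ⁅X, U⁆⁆ ∈ W := hW _ _ (hW _ _ hU)
  -- The identity u × (u × x) = (u·x)u - (u·u)x solved for x; the 4 is the square of the factor 2 in
  -- the bracket.
  have h2 : (4 * (su2Equiv U ⬝ᵥ su2Equiv U)) • X =
      ⁅U, ⁅X, U⁆⁆ + (4 * (su2Equiv U ⬝ᵥ su2Equiv X)) • U := by
    apply su2Equiv.injective
    rw [← lie_skew X U, lie_neg]
    simp only [map_add, map_smul, map_neg, su2Equiv_lie, cross_cross_self_eq]
    module
  have h3 := W.add_mem h1 (W.smul_mem (4 * (su2Equiv U ⬝ᵥ su2Equiv X)) hU)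
  rw [← h2] at h3
  exact (W.smul_mem_iff (by simpa using hu)).1 h3

/-- A Lie subalgebra of `su(2)` of dimension greater than one is the whole of `su(2)`. -/
theorem su2_subalgebra_finrank_le_one {W : Submodule ℝ su2}
    (hW : ∀ X ∈ W, ∀ Y ∈ W, ⁅X, Y⁆ ∈ W) (hne : W ≠ ⊤) : Module.finrank ℝ W ≤ 1 := by
  have hlie : ∀ X ∈ W, ∀ Y ∈ W, ⁅X, Y⁆ = 0 := by
    intro U hU V hV
    by_contra h
    refine hne (eq_top_iff.2 fun X _ => ?_)
    have hw := hW U hU V hV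
    set Z := ⁅U, V⁆ with hZ
    have hz : su2Equiv Z ⬝ᵥ su2Equiv Z ≠ 0 := dotProduct_self_ne_zero (by simpa using h)
    -- Cramer's rule in the basis u, v, z: as z = 2 u × v, the determinant det(u, v, z) is half of
    -- z·z, whence the factors 2.
    have h2 : (su2Equiv Z ⬝ᵥ su2Equiv Z) • X =
        (2 * (su2Equiv X ⬝ᵥ (su2Equiv V ⨯₃ su2Equiv Z))) • U +
        (2 * (su2Equiv U ⬝ᵥ (su2Equiv X ⨯₃ su2Equiv Z))) • V +
        (2 * (su2Equiv U ⬝ᵥ (su2Equiv V ⨯₃ su2Equiv X))) • Z := by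
      apply su2Equiv.injective
      simp only [map_add, map_smul, hZ, su2Equiv_lie]
      ext i
      fin_cases i <;> simp [cross_apply, dotProduct, Fin.sum_univ_three] <;> ring
    have h3 := W.add_mem (W.add_mem (W.smul_mem (2 * (su2Equiv X ⬝ᵥ (su2Equiv V ⨯₃ su2Equiv Z))) hU)
      (W.smul_mem (2 * (su2Equiv U ⬝ᵥ (su2Equiv X ⨯₃ su2Equiv Z))) hV))
      (W.smul_mem (2 * (su2Equiv U ⬝ᵥ (su2Equiv V ⨯₃ su2Equiv X))) hw)
    rw [← h2] at h3
    exact (W.smul_mem_iff hz).1 h3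
  by_cases hbot : W = ⊥
  · rw [hbot, finrank_bot]; exact zero_le_one
  obtain ⟨U, hU, hU0⟩ := Submodule.exists_mem_ne_zero_of_ne_bot hbot
  have hu : su2Equiv U ⬝ᵥ su2Equiv U ≠ 0 := dotProduct_self_ne_zero (by simpa using hU0)
  refine finrank_le_one (⟨U, hU⟩ : W) fun V => ?_
  refine ⟨(su2Equiv U ⬝ᵥ su2Equiv U)⁻¹ * (su2Equiv U ⬝ᵥ su2Equiv V.1), Subtype.ext ?_⟩
  apply su2Equiv.injective
  -- Commuting elements have parallel vectors, so every V is its orthogonal projection to the line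
  -- of U.
  have h0 : su2Equiv U ⨯₃ su2Equiv V.1 = 0 := by
    have := congrArg su2Equiv (hlie U hU V.1 V.2)
    rw [su2Equiv_lie, map_zero] at this
    simpa using this
  have h1 := cross_cross_self_eq (su2Equiv U) (su2Equiv V.1)
  rw [h0, map_zero, eq_comm, sub_eq_zero] at h1
  simp only [SetLike.mk_smul_mk, map_smul]
  rw [mul_smul, h1, smul_smul, inv_mul_cancel₀ hu, one_smul]

theorem finrank_su2 : Module.finrank ℝ su2 = 3 := by
  rw [su2Equiv.finrank_eq]; simp

instance : FiniteDimensional ℝ su2 := su2Equiv.symm.finiteDimensional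

/-- The element `iσ_z` of `su(2)`. -/
def su2Z : su2 := su2Equiv.symm ![1, 0, 0]

/-- The element `iσ_y` of `su(2)`. -/
def su2Y : su2 := su2Equiv.symm ![0, 1, 0]

theorem su2Y_ne_zero : su2Y ≠ 0 := by
  intro h
  have := congrFun (congrArg su2Equiv h) 1
  simp [su2Y] at this

theorem lie_su2Z_su2Y : ⁅su2Z, ⁅su2Z, su2Y⁆⁆ = (-4 : ℝ) • su2Y := by
  apply su2Equiv.injective
  simp only [su2Equiv_lie, map_smul, cross_cross_self_eq]
  ext i
  fin_cases i <;> simp [su2Z, su2Y, dotProduct, Fin.sum_univ_three]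
  norm_num

/-- The double bracket is 4((p·q)p - (p·p)q). Pairing the relation with p gives p·q = 0, and then
pairing with q gives p·p = 1. The hypothesis involves brackets only, so it can be carried from one
qubit of a block to another. -/
theorem mul_self_eq_neg_one_of_lie_lie {P Q : su2} (h : ⁅P, ⁅P, Q⁆⁆ = (-4 : ℝ) • Q) (hQ : Q ≠ 0) :
    (P : Matrix (Fin 2) (Fin 2) ℂ) * P = -1 := by
  have h1 := congrArg su2Equiv h
  simp only [su2Equiv_lie, map_smul, cross_cross_self_eq] at h1
  have hq : su2Equiv Q ⬝ᵥ su2Equiv Q ≠ 0 := dotProduct_self_ne_zero (by simpa using hQ)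
  have h2 := congrArg (fun v => su2Equiv P ⬝ᵥ v) h1
  have h3 := congrArg (fun v => su2Equiv Q ⬝ᵥ v) h1
  simp only [dotProduct_smul, dotProduct_sub, smul_eq_mul] at h2 h3
  have h4 : su2Equiv P ⬝ᵥ su2Equiv Q = 0 := by linear_combination (1 / 4) * h2
  rw [dotProduct_comm (su2Equiv Q) (su2Equiv P), h4] at h3
  have h5 : su2Equiv P ⬝ᵥ su2Equiv P = 1 := by
    apply mul_right_cancel₀ hq
    linear_combination -(1 / 4) * h3
  rw [su2_mul_self, h5]; simp

/-- Schur's lemma for the irreducible representation ℂ²; commuting with iσ_z and iσ_y already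
suffices. -/
theorem eq_scalar_of_commute {N : Matrix (Fin 2) (Fin 2) ℂ} (hN : ∀ A : su2, A.1 * N = N * A.1) :
    N = N 0 0 • (1 : Matrix (Fin 2) (Fin 2) ℂ) := by
  have hz := hN su2Z
  have hy := hN su2Y
  simp only [su2Z, su2Y, coe_su2Equiv_symm] at hz hy
  have e1 := congrFun (congrFun hz 0) 1
  have e2 := congrFun (congrFun hz 1) 0
  have e3 := congrFun (congrFun hy 0) 1
  simp [Matrix.mul_apply, Fin.sum_univ_two, Complex.ext_iff] at e1 e2 e3
  ext i j
  fin_cases i <;> fin_cases j <;> simp [Complex.ext_iff] <;> constructor <;> linarith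

variable {n : ℕ}

/-! ### Projections to single qubits and the Goursat argument -/

/-- The projection of a subalgebra of `𝔤` to the summand `su(2)` of qubit `k`. -/
def siteProj (K : LieSubalgebra ℝ (LocalLie n)) (k : Fin n) : K →ₗ[ℝ] su2 :=
  LinearMap.proj k ∘ₗ LinearMap.snd ℝ ℝ (Fin n → su2) ∘ₗ K.toSubmodule.subtype

theorem siteProj_apply (K : LieSubalgebra ℝ (LocalLie n)) (k : Fin n) (X : K) :
    siteProj K k X = X.1.2 k := rfl

theorem siteProj_lie (K : LieSubalgebra ℝ (LocalLie n)) (k : Fin n) (X Y : K) :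
    siteProj K k ⁅X, Y⁆ = ⁅siteProj K k X, siteProj K k Y⁆ := rfl

theorem fst_lie (K : LieSubalgebra ℝ (LocalLie n)) (X Y : K) : (⁅X, Y⁆ : K).1.1 = 0 := by
  change ⁅X.1.1, Y.1.1⁆ = 0
  rw [Ring.lie_def, mul_comm, sub_self]

instance (K : LieSubalgebra ℝ (LocalLie n)) : FiniteDimensional ℝ K :=
  inferInstanceAs (FiniteDimensional ℝ K.toSubmodule)

theorem finrank_range_siteProj_le_one {K : LieSubalgebra ℝ (LocalLie n)} {k : Fin n}
    (hk : LinearMap.range (siteProj K k) ≠ ⊤) :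
    Module.finrank ℝ (LinearMap.range (siteProj K k)) ≤ 1 := by
  refine su2_subalgebra_finrank_le_one ?_ hk
  rintro _ ⟨X, rfl⟩ _ ⟨Y, rfl⟩
  exact ⟨⁅X, Y⁆, siteProj_lie K k X Y⟩

/-- Rank 3 is the largest possible, so the kernel at `j` has the least possible dimension and cannot
properly contain the kernel at `k`. -/
theorem ker_siteProj_eq {K : LieSubalgebra ℝ (LocalLie n)} {j k : Fin n}
    (hj : LinearMap.range (siteProj K j) = ⊤)
    (hk : LinearMap.ker (siteProj K k) ≤ LinearMap.ker (siteProj K j)) :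
    LinearMap.ker (siteProj K k) = LinearMap.ker (siteProj K j) := by
  refine Submodule.eq_of_le_of_finrank_le hk ?_
  have h1 := (siteProj K k).finrank_range_add_finrank_ker
  have h2 := (siteProj K j).finrank_range_add_finrank_ker
  have h3 := Submodule.finrank_le (LinearMap.range (siteProj K k))
  rw [hj, finrank_top] at h2
  omega

theorem range_siteProj_eq_top_of_ker_eq {K : LieSubalgebra ℝ (LocalLie n)} {j k : Fin n}
    (hj : LinearMap.range (siteProj K j) = ⊤)
    (hk : LinearMap.ker (siteProj K k) = LinearMap.ker (siteProj K j)) :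
    LinearMap.range (siteProj K k) = ⊤ := by
  refine Submodule.eq_top_of_finrank_eq ?_
  have h1 := (siteProj K k).finrank_range_add_finrank_ker
  have h2 := (siteProj K j).finrank_range_add_finrank_ker
  rw [hj, finrank_top] at h2
  rw [hk] at h1
  omega

/-- The image under `siteProj K j` of an ideal of `K`, when `siteProj K j` is onto. -/
theorem map_siteProj_eq_top {K : LieSubalgebra ℝ (LocalLie n)} {j : Fin n}
    (hj : LinearMap.range (siteProj K j) = ⊤) {I : Submodule ℝ K}
    (hI : ∀ X : K, ∀ Y ∈ I, ⁅X, Y⁆ ∈ I) (hne : ¬ I ≤ LinearMap.ker (siteProj K j)) :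
    I.map (siteProj K j) = ⊤ := by
  refine su2_ideal_eq_top ?_ ?_
  · rintro A _ ⟨Y, hY, rfl⟩
    obtain ⟨X, rfl⟩ := LinearMap.range_eq_top.1 hj A
    exact ⟨⁅X, Y⁆, hI X Y hY, siteProj_lie K j X Y⟩
  · intro h
    exact hne (fun Y hY => LinearMap.mem_ker.2
      ((Submodule.mem_bot ℝ).1 (h ▸ Submodule.mem_map_of_mem hY)))

theorem lie_su2Z_su2Y_ne_zero : ⁅su2Z, su2Y⁆ ≠ 0 := by
  intro h
  have := lie_su2Z_su2Y
  rw [h, lie_zero, eq_comm, smul_eq_zero] at this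
  exact this.elim (by norm_num) su2Y_ne_zero

/-- The ideal of elements of `K` without phase that vanish at the qubits in `F`. -/
def vanishIdeal (K : LieSubalgebra ℝ (LocalLie n)) (F : Finset (Fin n)) : Submodule ℝ K where
  carrier := {X | X.1.1 = 0 ∧ ∀ k ∈ F, siteProj K k X = 0}
  add_mem' := by
    rintro X Y ⟨hX, hX'⟩ ⟨hY, hY'⟩
    refine ⟨?_, fun k hk => by rw [map_add, hX' k hk, hY' k hk, add_zero]⟩
    change X.1.1 + Y.1.1 = 0
    rw [hX, hY, add_zero]
  zero_mem' := ⟨rfl, fun k _ => map_zero _⟩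
  smul_mem' := by
    rintro c X ⟨hX, hX'⟩
    refine ⟨?_, fun k hk => by rw [map_smul, hX' k hk, smul_zero]⟩
    change c * X.1.1 = 0
    rw [hX, mul_zero]

/-- Induction on `F`, using that ideals of `K` project to ideals of the simple algebra su(2). To add
`k`, bracket an element vanishing on `F` with one vanishing at `k`: the result vanishes at both, and
its component at `j` can be made a nonzero commutator. In the base case a bracket removes the phase,
since u(1) is abelian. -/
theorem map_vanishIdeal_eq_top {K : LieSubalgebra ℝ (LocalLie n)} {j : Fin n}
    (hj : LinearMap.range (siteProj K j) = ⊤) (F : Finset (Fin n))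
    (hF : ∀ k ∈ F, ¬ LinearMap.ker (siteProj K k) ≤ LinearMap.ker (siteProj K j)) :
    (vanishIdeal K F).map (siteProj K j) = ⊤ := by
  classical
  have hideal : ∀ F : Finset (Fin n), ∀ X : K, ∀ Y ∈ vanishIdeal K F, ⁅X, Y⁆ ∈ vanishIdeal K F :=
    fun F X Y hY => ⟨fst_lie K X Y, fun k hk => by rw [siteProj_lie, hY.2 k hk, lie_zero]⟩
  have hsurj := LinearMap.range_eq_top.1 hj
  induction F using Finset.induction_on with
  | empty =>
    refine map_siteProj_eq_top hj (hideal ∅) fun h => ?_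
    obtain ⟨X, hX⟩ := hsurj su2Z
    obtain ⟨Y, hY⟩ := hsurj su2Y
    have := h (x := ⁅X, Y⁆) ⟨fst_lie K X Y, by simp⟩
    rw [LinearMap.mem_ker, siteProj_lie, hX, hY] at this
    exact lie_su2Z_su2Y_ne_zero this
  | insert k F _ ih =>
    have ih := ih fun i hi => hF i (Finset.mem_insert_of_mem hi)
    have hk : (LinearMap.ker (siteProj K k)).map (siteProj K j) = ⊤ :=
      map_siteProj_eq_top hj (fun X Y hY => by
        rw [LinearMap.mem_ker] at hY ⊢
        rw [siteProj_lie, hY, lie_zero]) (hF k (Finset.mem_insert_self k F))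
    refine map_siteProj_eq_top hj (hideal _) fun h => ?_
    obtain ⟨X, hXF, hX⟩ : su2Z ∈ (vanishIdeal K F).map (siteProj K j) := ih ▸ Submodule.mem_top
    obtain ⟨Y, hYk, hY⟩ : su2Y ∈ (LinearMap.ker (siteProj K k)).map (siteProj K j) :=
      hk ▸ Submodule.mem_top
    have hYk : siteProj K k Y = 0 := hYk
    have := h (x := ⁅X, Y⁆) ⟨fst_lie K X Y, fun i hi => by
      rw [siteProj_lie]
      rcases Finset.mem_insert.1 hi with rfl | hi
      · rw [hYk, lie_zero]
      · rw [hXF.2 i hi, zero_lie]⟩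
    rw [LinearMap.mem_ker, siteProj_lie, hX, hY] at this
    exact lie_su2Z_su2Y_ne_zero this

open scoped Classical in
/-- The qubits `k` for which `siteProj K k` has the same kernel as `siteProj K j`. -/
def block (K : LieSubalgebra ℝ (LocalLie n)) (j : Fin n) : Finset (Fin n) :=
  {k | LinearMap.ker (siteProj K k) = LinearMap.ker (siteProj K j)}

theorem mem_block {K : LieSubalgebra ℝ (LocalLie n)} {j k : Fin n} :
    k ∈ block K j ↔ LinearMap.ker (siteProj K k) = LinearMap.ker (siteProj K j) := by
  simp [block]

theorem exists_supported_on_block {K : LieSubalgebra ℝ (LocalLie n)} {j : Fin n}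
    (hj : LinearMap.range (siteProj K j) = ⊤) (A : su2) :
    ∃ X ∈ K, X.1 = 0 ∧ X.2 j = A ∧ ∀ k ∉ block K j, X.2 k = 0 := by
  have h := map_vanishIdeal_eq_top hj (block K j)ᶜ fun k hk hle =>
    Finset.mem_compl.1 hk (mem_block.2 (ker_siteProj_eq hj hle))
  obtain ⟨X, hX, hXA⟩ : A ∈ (vanishIdeal K (block K j)ᶜ).map (siteProj K j) :=
    h ▸ Submodule.mem_top
  exact ⟨X.1, X.2, hX.1, hXA, fun k hk => hX.2 k (Finset.mem_compl.2 hk)⟩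

/-- Choose Y in `K` with component iσ_y at `j`. The relation [X, [X, Y]] = -4Y holds modulo the
kernel at `j`, which is also the kernel at `k`, so it holds for the components at `k`. -/
theorem mul_self_of_mem_block {K : LieSubalgebra ℝ (LocalLie n)} {j k : Fin n}
    (hj : LinearMap.range (siteProj K j) = ⊤) (hk : k ∈ block K j) {X : LocalLie n} (hX : X ∈ K)
    (hXj : X.2 j = su2Z) :
    (X.2 k : Matrix (Fin 2) (Fin 2) ℂ) * (X.2 k : Matrix (Fin 2) (Fin 2) ℂ) = -1 := by
  obtain ⟨Y, hY⟩ := LinearMap.range_eq_top.1 hj su2Y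
  rw [mem_block] at hk
  have h1 : (⁅(⟨X, hX⟩ : K), ⁅(⟨X, hX⟩ : K), Y⁆⁆ - (-4 : ℝ) • Y) ∈
      LinearMap.ker (siteProj K k) := by
    rw [hk, LinearMap.mem_ker, map_sub, map_smul, siteProj_lie, siteProj_lie, hY,
      siteProj_apply, hXj, lie_su2Z_su2Y, sub_self]
  rw [LinearMap.mem_ker, map_sub, map_smul, siteProj_lie, siteProj_lie, sub_eq_zero] at h1
  refine mul_self_eq_neg_one_of_lie_lie h1 fun h0 => ?_
  have : Y ∈ LinearMap.ker (siteProj K j) := hk ▸ LinearMap.mem_ker.2 h0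
  rw [LinearMap.mem_ker, hY] at this
  exact su2Y_ne_zero this

/-! ### One-qubit operators and criteria for being a product -/

theorem mem_stabilizer {ψ : QubitSpace (Fin n)} {X : LocalLie n} :
    X ∈ stabilizer ψ ↔ infAct X ψ.ofLp = 0 := by
  change dPhi ψ X = 0 ↔ _
  rw [dPhi_eq, WithLp.toLp_eq_zero]

theorem siteOp_apply (j : Fin n) (M : Matrix (Fin 2) (Fin 2) ℂ) (v : (Fin n → Fin 2) → ℂ)
    (I : Fin n → Fin 2) : siteOp j M v I = ∑ a, M (I j) a * v (Function.update I j a) := rfl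

theorem siteOp_zero (j : Fin n) : siteOp j (0 : Matrix (Fin 2) (Fin 2) ℂ) = 0 := by
  simpa using siteOp_sub j 0 0

theorem siteOp_one (j : Fin n) : siteOp j (1 : Matrix (Fin 2) (Fin 2) ℂ) = 1 := by
  refine LinearMap.ext fun v => funext fun I => ?_
  simp [siteOp_apply, Matrix.one_apply]

theorem siteOp_siteOp_self {A : Matrix (Fin 2) (Fin 2) ℂ} (hA : A * A = -1) (j : Fin n)
    (v : (Fin n → Fin 2) → ℂ) : siteOp j A (siteOp j A v) = -v := by
  rw [← Module.End.mul_apply, ← siteOp_mul, hA, ← zero_sub, siteOp_sub, siteOp_zero, siteOp_one,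
    zero_sub]
  rfl

/-- Lets both factors be written as functions of the full index; the coordinates a factor ignores
are filled with 0. -/
theorem isProduct_of_eq_mul {ψ : QubitSpace (Fin n)} {S : Finset (Fin n)} (hS : S.Nonempty)
    (hS' : Sᶜ.Nonempty) {f g : (Fin n → Fin 2) → ℂ}
    (hf : ∀ I J, (∀ j ∈ S, I j = J j) → f I = f J) (hg : ∀ I J, (∀ j ∉ S, I j = J j) → g I = g J)
    (h : ∀ I, ψ I = f I * g I) : IsProduct ψ := by
  refine ⟨S, hS, hS',
    WithLp.toLp 2 fun a => f fun j => if hj : j ∈ S then a ⟨j, hj⟩ else 0,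
    WithLp.toLp 2 fun b => g fun j => if hj : j ∉ S then b ⟨j, hj⟩ else 0, fun I => ?_⟩
  rw [h]
  congr 1
  · exact hf _ _ fun j hj => by simp [hj]
  · exact hg _ _ fun j hj => by simp [hj]

/-- A linear relation between the two slices of `ψ` at a qubit makes `ψ` a product. -/
theorem isProduct_of_slices (hn : 2 ≤ n) {ψ : QubitSpace (Fin n)} (k : Fin n) {b : Fin 2 → ℂ}
    (hb : b ≠ 0) (h : ∀ I, ∑ a, b a * ψ (Function.update I k a) = 0) : IsProduct ψ := by
  have hS' : ({k} : Finset (Fin n))ᶜ.Nonempty := by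
    rw [← Finset.card_pos, Finset.card_compl, Finset.card_singleton, Fintype.card_fin]; omega
  have hg : ∀ (c : Fin 2) (I J : Fin n → Fin 2), (∀ j ∉ ({k} : Finset (Fin n)), I j = J j) →
      Function.update I k c = Function.update J k c := by
    intro c I J hIJ
    ext j
    by_cases hj : j = k
    · subst hj; simp
    · simp [Function.update_of_ne hj, hIJ j (by simpa using hj)]
  have hI : ∀ I : Fin n → Fin 2, ∀ c, I k = c → ψ I = ψ (Function.update I k c) := by
    rintro I _ rfl
    rw [Function.update_eq_self]
  simp only [Fin.sum_univ_two] at h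
  by_cases hb0 : b 0 = 0
  · have hb1 : b 1 ≠ 0 := fun hb1 => hb (funext fun i => by fin_cases i <;> assumption)
    refine isProduct_of_eq_mul (S := {k}) (Finset.singleton_nonempty k) hS'
      (f := fun I => ![1, 0] (I k)) (g := fun I => ψ (Function.update I k 0))
      (fun I J hIJ => by simp [hIJ k (by simp)]) (fun I J hIJ => by rw [hg 0 I J hIJ])
      fun I => ?_
    have h := h I
    obtain h0 | h0 : I k = 0 ∨ I k = 1 := by omega
    · simp [h0, ← hI I 0 h0]
    · rw [hb0, zero_mul, zero_add, ← hI I 1 h0] at h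
      simpa [h0] using (mul_eq_zero.1 h).resolve_left hb1
  -- The one-qubit factor (-b₁, b₀) spans the vectors annihilated by b; dividing by b₀ fixes the
  -- scale of the other factor.
  · refine isProduct_of_eq_mul (S := {k}) (Finset.singleton_nonempty k) hS'
      (f := fun I => ![-b 1, b 0] (I k)) (g := fun I => ψ (Function.update I k 1) / b 0)
      (fun I J hIJ => by simp [hIJ k (by simp)]) (fun I J hIJ => by rw [hg 1 I J hIJ])
      fun I => ?_
    have h := h I
    obtain h0 | h0 : I k = 0 ∨ I k = 1 := by omega
    · simp only [h0, Matrix.cons_val_zero]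
      rw [← hI I 0 h0] at h
      field_simp
      linear_combination h
    · simp only [h0, Matrix.cons_val_one, Matrix.cons_val_fin_one]
      rw [← hI I 1 h0]
      field_simp

/-- A stabilizer element of a nonproduct state that acts on a single qubit vanishes. -/
theorem eq_zero_of_supported_on_site (hn : 2 ≤ n) {ψ : QubitSpace (Fin n)}
    (hprod : ¬ IsProduct ψ) {X : LocalLie n} (hX : X ∈ stabilizer ψ) (k : Fin n)
    (hk : ∀ i ≠ k, X.2 i = 0) : X = 0 := by
  rw [mem_stabilizer, infAct, Finset.sum_eq_single k
    (fun i _ hi => by rw [hk i hi]; exact siteOp_zero i) (by simp)] at hX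
  -- Each row of iθ + X_k is a linear relation between the two slices of ψ at `k`, so it must
  -- vanish. The trace then separates θ from X_k.
  have hrow : ∀ r, (fun a => (X.1 * Complex.I) * (1 : Matrix (Fin 2) (Fin 2) ℂ) r a +
      (X.2 k).1 r a) = 0 := by
    intro r
    by_contra hb
    refine hprod (isProduct_of_slices hn k hb fun I => ?_)
    have h := congrFun hX (Function.update I k r)
    simp only [LinearMap.add_apply, LinearMap.smul_apply, Module.End.one_apply, Pi.add_apply,
      Pi.smul_apply, smul_eq_mul, siteOp_apply, Function.update_self, Function.update_idem,
      Pi.zero_apply] at h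
    simp only [add_mul, Finset.sum_add_distrib]
    rw [← h]
    simp [Matrix.one_apply]
  have htr : (X.2 k).1 0 0 + (X.2 k).1 1 1 = 0 := by
    rw [← Matrix.trace_fin_two]; exact (X.2 k).2.2
  have h00 := congrFun (hrow 0) 0
  have h01 := congrFun (hrow 0) 1
  have h10 := congrFun (hrow 1) 0
  have h11 := congrFun (hrow 1) 1
  simp at h00 h01 h10 h11
  have hθ : (X.1 : ℂ) * Complex.I = 0 := by linear_combination (h00 + h11 - htr) / 2
  rw [hθ, zero_add] at h00 h11
  refine Prod.ext (by simpa using hθ) (funext fun i => ?_)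
  by_cases hi : i = k
  · subst hi
    refine Subtype.ext (Matrix.ext fun a b => ?_)
    fin_cases a <;> fin_cases b <;> assumption
  · exact hk i hi

/-! ### One and two qubits -/

/-- The phase coordinate is injective on the stabilizer: without phase, Xψ = 0, and X² is the scalar
-|x|², so x = 0. -/
theorem finrank_stabilizer_one {ψ : QubitSpace (Fin 1)} (hψ : ψ ≠ 0) :
    Module.finrank ℝ (stabilizer ψ) ≤ 1 := by
  let L : stabilizer ψ →ₗ[ℝ] ℝ :=
    LinearMap.fst ℝ ℝ (Fin 1 → su2) ∘ₗ (stabilizer ψ).toSubmodule.subtype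
  have hL : Function.Injective L := by
    refine (injective_iff_map_eq_zero L).2 fun X hX => ?_
    have hX : X.1.1 = 0 := hX
    have h := mem_stabilizer.1 X.2
    simp only [infAct, hX, Complex.ofReal_zero, zero_mul, zero_smul, zero_add,
      Finset.univ_unique, Finset.sum_singleton] at h
    have h2 := congrArg (siteOp default (X.1.2 default).1) h
    rw [map_zero, ← Module.End.mul_apply, ← siteOp_mul, su2_mul_self, siteOp_smul,
      siteOp_one, LinearMap.smul_apply, Module.End.one_apply, smul_eq_zero] at h2
    have h3 := h2.resolve_right (by simpa using hψ)
    rw [Complex.ofReal_eq_zero, neg_eq_zero, dotProduct_self_eq_zero] at h3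
    refine Subtype.ext (Prod.ext hX (funext fun i => ?_))
    rw [Subsingleton.elim i default]
    simpa using h3
  simpa using LinearMap.finrank_le_finrank_of_injective hL

/-- An element in the kernel of one projection acts on the other qubit only, so the stabilizer
embeds in su(2). -/
theorem finrank_stabilizer_two {ψ : QubitSpace (Fin 2)}
    (hprod : ¬ IsProduct ψ) : Module.finrank ℝ (stabilizer ψ) ≤ 3 := by
  have hL : Function.Injective (siteProj (stabilizer ψ) 1) := by
    refine (injective_iff_map_eq_zero _).2 fun X hX => ?_
    refine Subtype.ext (eq_zero_of_supported_on_site le_rfl hprod X.2 0 fun i hi => ?_)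
    obtain rfl : i = 1 := by omega
    exact hX
  exact finrank_su2 ▸ LinearMap.finrank_le_finrank_of_injective hL

/-! ### Lower bound for the size of a block -/

/-- If qubits `j`, `k` carry correlated copies of `su(2)` that annihilate `ψ`, then `ψ` is the
product of a state of `j`, `k` and a state of the remaining qubits. -/
theorem isProduct_of_pair (hn : 3 ≤ n) {ψ : QubitSpace (Fin n)} (hψ : ψ ≠ 0) {j k : Fin n}
    (hjk : j ≠ k) (h : ∀ A : su2, ∃ B : su2,
      siteOp j A.1 ψ.ofLp + siteOp k B.1 ψ.ofLp = 0) : IsProduct ψ := by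
  -- `M I` is the 2 × 2 coefficient matrix of qubits `j`, `k` with the remaining qubits frozen at
  -- `I`. The hypothesis becomes A M = -M Bᵀ, with B independent of `I`.
  let M : (Fin n → Fin 2) → Matrix (Fin 2) (Fin 2) ℂ := fun I =>
    Matrix.of fun a b => ψ (Function.update (Function.update I j a) k b)
  have hMψ : ∀ I, ψ I = M I (I j) (I k) := fun I => by simp [M]
  have hM : ∀ I J, (∀ i ∉ ({j, k} : Finset (Fin n)), I i = J i) → M I = M J := by
    intro I J hIJ
    ext a b
    simp only [M, Matrix.of_apply]
    refine congrArg ψ.ofLp (funext fun i => ?_)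
    by_cases hi : i = k
    · subst hi; simp
    · by_cases hi' : i = j
      · subst hi'; simp [hi]
      · simp [hi, hi', hIJ i (by simp [hi, hi'])]
  have hrel : ∀ A : su2, ∃ B : su2, ∀ I, A.1 * M I = -(M I * B.1ᵀ) := by
    intro A
    obtain ⟨B, hB⟩ := h A
    refine ⟨B, fun I => ?_⟩
    ext a b
    have h1 := congrFun hB (Function.update (Function.update I j a) k b)
    simp only [Pi.add_apply, siteOp_apply, Function.update_self, Function.update_idem,
      Function.update_of_ne hjk, Pi.zero_apply] at h1
    have h2 : ∀ c, Function.update (Function.update (Function.update I j a) k b) j c =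
        Function.update (Function.update I j c) k b := fun c => by
      rw [Function.update_comm hjk.symm, Function.update_idem]
    simp only [h2] at h1
    simp only [Matrix.mul_apply, Matrix.neg_apply, M, Matrix.of_apply, Matrix.transpose_apply]
    rw [eq_neg_iff_add_eq_zero, ← h1]
    congr 1
    exact Finset.sum_congr rfl fun c _ => mul_comm _ _
  -- Since A and Bᵀ are skew-Hermitian, B cancels and M(I)M(J)ᴴ commutes with all of su(2). Being
  -- scalar, these products make every `M I` a multiple of one invertible `M I₀`.
  have hcomm : ∀ I J, M I * (M J)ᴴ = (M I * (M J)ᴴ) 0 0 • (1 : Matrix (Fin 2) (Fin 2) ℂ) := by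
    intro I J
    refine eq_scalar_of_commute fun A => ?_
    obtain ⟨B, hB⟩ := hrel A
    have hJ := congrArg Matrix.conjTranspose (hB J)
    have hBt : (B.1ᵀ)ᴴ = -B.1ᵀ := by
      rw [← Matrix.transpose_neg, ← B.2.1]; rfl
    rw [Matrix.conjTranspose_neg, Matrix.conjTranspose_mul, Matrix.conjTranspose_mul, hBt, A.2.1,
      mul_neg, neg_mul, neg_neg] at hJ
    have hJ' : (M J)ᴴ * A.1 = -(B.1ᵀ * (M J)ᴴ) := neg_eq_iff_eq_neg.1 hJ
    rw [← mul_assoc, hB I, mul_assoc (M I), hJ', mul_neg, neg_mul, mul_assoc]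
  obtain ⟨I₀, hI₀⟩ : ∃ I, ψ I ≠ 0 := by
    by_contra! hcon
    exact hψ (by ext I; exact hcon I)
  have hM0 : M I₀ ≠ 0 := fun h0 => hI₀ (by rw [hMψ, h0]; rfl)
  set c : ℂ := (M I₀ * (M I₀)ᴴ) 0 0 with hc
  have hc0 : c ≠ 0 := by
    intro h0
    have := hcomm I₀ I₀
    rw [← hc, h0, zero_smul, Matrix.self_mul_conjTranspose_eq_zero] at this
    exact hM0 this
  have hinv : (M I₀)ᴴ * M I₀ = c • 1 := by
    have h1 : (M I₀) * (c⁻¹ • (M I₀)ᴴ) = 1 := by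
      rw [mul_smul_comm, hcomm I₀ I₀, ← hc, smul_smul, inv_mul_cancel₀ hc0, one_smul]
    have h2 := mul_eq_one_comm.1 h1
    rw [smul_mul_assoc] at h2
    rw [← h2, smul_smul, mul_inv_cancel₀ hc0, one_smul]
  have hprop : ∀ I, M I = ((M I * (M I₀)ᴴ) 0 0 / c) • M I₀ := by
    intro I
    have h1 := congrArg (· * M I₀) (hcomm I I₀)
    simp only [mul_assoc, hinv, mul_smul_comm, smul_mul_assoc, mul_one, one_mul] at h1
    rw [div_eq_inv_mul, mul_smul, ← h1, smul_smul, inv_mul_cancel₀ hc0, one_smul]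
  refine isProduct_of_eq_mul (S := {j, k}) ⟨j, by simp⟩ ?_ (f := fun I => M I₀ (I j) (I k))
    (g := fun I => (M I * (M I₀)ᴴ) 0 0 / c) (fun I J hIJ => by simp [hIJ j, hIJ k])
    (fun I J hIJ => by rw [hM I J hIJ]) fun I => ?_
  · rw [← Finset.card_pos, Finset.card_compl, Finset.card_pair hjk, Fintype.card_fin]; omega
  · rw [hMψ, hprop I, Matrix.smul_apply, smul_eq_mul, mul_comm, ← hprop I]

/-- Three operators squaring to minus one, acting on distinct qubits, have an injective sum. -/
theorem eq_zero_of_siteOp_three {j k l : Fin n} (hjk : j ≠ k) (hjl : j ≠ l) (hkl : k ≠ l)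
    {A B C : Matrix (Fin 2) (Fin 2) ℂ} (hA : A * A = -1) (hB : B * B = -1) (hC : C * C = -1)
    {v : (Fin n → Fin 2) → ℂ} (h : siteOp j A v + (siteOp k B v + siteOp l C v) = 0) :
    v = 0 := by
  have hcomm : siteOp k B (siteOp j A v) = siteOp j A (siteOp k B v) := by
    rw [← Module.End.mul_apply, ← Module.End.mul_apply, siteOp_comm hjk]
  have hv := siteOp_siteOp_self hC l v
  have hC' : siteOp l C v = -(siteOp j A v + siteOp k B v) := by
    rw [eq_neg_iff_add_eq_zero, ← h]; abel
  have hlj : siteOp l C (siteOp j A v) = siteOp j A (siteOp l C v) := by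
    rw [← Module.End.mul_apply, ← Module.End.mul_apply, siteOp_comm hjl]
  have hlk : siteOp l C (siteOp k B v) = siteOp k B (siteOp l C v) := by
    rw [← Module.End.mul_apply, ← Module.End.mul_apply, siteOp_comm hkl]
  rw [hC', map_neg, map_add, hlj, hlk, hC', map_neg, map_neg, map_add, map_add, hcomm,
    siteOp_siteOp_self hA, siteOp_siteOp_self hB] at hv
  -- With a, b, c the three operators, c²v = (a + b)²v reads -v = -2v + 2abv. As (ab)² = 1, this
  -- gives v = v/4.
  have hw : siteOp j A (siteOp k B v) = (2⁻¹ : ℂ) • v := by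
    linear_combination (norm := module) (2⁻¹ : ℂ) • hv
  have h1 : siteOp k B (siteOp j A (siteOp j A (siteOp k B v))) = v := by
    rw [siteOp_siteOp_self hA, map_neg, siteOp_siteOp_self hB, neg_neg]
  rw [hw, map_smul, map_smul, hcomm, hw] at h1
  have h2 : (-(3 / 4) : ℂ) • v = 0 := by linear_combination (norm := module) h1
  exact (smul_eq_zero.1 h2).resolve_left (by norm_num)

theorem four_le_card_block (hn : 3 ≤ n) {ψ : QubitSpace (Fin n)} (hψ : ψ ≠ 0)
    (hprod : ¬ IsProduct ψ) {j : Fin n}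
    (hj : LinearMap.range (siteProj (stabilizer ψ) j) = ⊤) :
    4 ≤ (block (stabilizer ψ) j).card := by
  have hψ' : ψ.ofLp ≠ 0 := by simpa using hψ
  set B := block (stabilizer ψ) j with hB
  have hjB : j ∈ B := mem_block.2 rfl
  have hact : ∀ A : su2, ∃ X ∈ stabilizer ψ, X.2 j = A ∧
      ∑ k ∈ B, siteOp k (X.2 k).1 ψ.ofLp = 0 := by
    intro A
    obtain ⟨X, hX, hX0, hXA, hXB⟩ := exists_supported_on_block hj A
    refine ⟨X, hX, hXA, ?_⟩
    rw [mem_stabilizer, infAct, hX0] at hX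
    simp only [Complex.ofReal_zero, zero_mul, zero_smul, zero_add, LinearMap.sum_apply] at hX
    rw [← hX]
    refine Finset.sum_subset (Finset.subset_univ B) fun k _ hk => ?_
    rw [hXB k hk]
    exact LinearMap.congr_fun (siteOp_zero k) _
  obtain ⟨X, hX, hXj, hsum⟩ := hact su2Z
  have hsq : ∀ k ∈ B, (X.2 k).1 * (X.2 k).1 = -1 := fun k hk =>
    mul_self_of_mem_block hj hk hX hXj
  by_contra! hlt
  interval_cases hcard : B.card
  · exact Finset.card_ne_zero_of_mem hjB hcard
  · obtain ⟨a, ha⟩ := Finset.card_eq_one.1 hcard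
    rw [ha, Finset.sum_singleton] at hsum
    have := siteOp_siteOp_self (hsq a (by simp [ha])) a ψ.ofLp
    rw [hsum, map_zero, eq_comm, neg_eq_zero] at this
    exact hψ' this
  · obtain ⟨k, hk⟩ := Finset.card_eq_one.1
      (show (B.erase j).card = 1 by rw [Finset.card_erase_of_mem hjB, hcard])
    have hkj : k ≠ j := Finset.ne_of_mem_erase (hk ▸ Finset.mem_singleton_self k : k ∈ B.erase j)
    refine hprod (isProduct_of_pair hn hψ hkj.symm fun A => ?_)
    obtain ⟨Y, -, hYj, hY⟩ := hact A
    rw [← Finset.add_sum_erase _ _ hjB, hk, Finset.sum_singleton, hYj] at hY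
    exact ⟨Y.2 k, hY⟩
  · obtain ⟨a, b, c, hab, hac, hbc, habc⟩ := Finset.card_eq_three.1 hcard
    rw [habc, Finset.sum_insert (by simp [hab, hac]), Finset.sum_pair hbc] at hsum
    exact hψ' (eq_zero_of_siteOp_three hab hac hbc (hsq a (by simp [habc]))
      (hsq b (by simp [habc])) (hsq c (by simp [habc])) hsum)

/-! ### The dimension count for three or more qubits -/

/-- The phase of a stabilizer element is determined by its `su(2)` components. -/
theorem eq_zero_of_snd_eq_zero {ψ : QubitSpace (Fin n)} (hψ : ψ ≠ 0) {X : LocalLie n}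
    (hX : X ∈ stabilizer ψ) (h : X.2 = 0) : X = 0 := by
  refine Prod.ext ?_ h
  have hz : ∀ k, siteOp k (X.2 k).1 = 0 := fun k => by rw [h]; exact siteOp_zero k
  rw [mem_stabilizer, infAct, Finset.sum_eq_zero fun k _ => hz k, add_zero, LinearMap.smul_apply,
    Module.End.one_apply, smul_eq_zero] at hX
  simpa using hX.resolve_right (by simpa using hψ)

theorem finrank_stabilizer_of_three_le (hn : 3 ≤ n) {ψ : QubitSpace (Fin n)} (hψ : ψ ≠ 0)
    (hprod : ¬ IsProduct ψ) : Module.finrank ℝ (stabilizer ψ) ≤ n - 1 := by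
  classical
  set K := stabilizer ψ with hK
  let S : Finset (Fin n) := {k | LinearMap.range (siteProj K k) = ⊤}
  have hS : ∀ k, k ∈ S ↔ LinearMap.range (siteProj K k) = ⊤ := by simp [S]
  let κ : Fin n → Submodule ℝ K := fun k => LinearMap.ker (siteProj K k)
  -- `R` contains one representative of each block in `S`. Blocks of qubits in `S` stay inside `S`,
  -- so each fibre of `κ` on `S` has at least four elements.
  obtain ⟨R, hRS, hRinj, hRim⟩ := Finset.exists_subset_injOn_image_eq_of_surjOn (f := κ) S
    (S.image κ) (by rw [Finset.coe_image]; exact Set.surjOn_image _ _)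
  have hRS : R ⊆ S := by exact_mod_cast hRS
  have h4 : 4 * R.card ≤ S.card := by
    rw [← Finset.card_image_of_injOn hRinj, hRim]
    refine Finset.mul_card_image_le_card (s := S) (f := κ) 4 fun a ha => ?_
    obtain ⟨j, hj, rfl⟩ := Finset.mem_image.1 ha
    refine (four_le_card_block hn hψ hprod ((hS j).1 hj)).trans (Finset.card_le_card fun k hk => ?_)
    have hk := mem_block.1 hk
    exact Finset.mem_filter.2 ⟨(hS k).2 (range_siteProj_eq_top_of_ker_eq ((hS j).1 hj) hk), hk⟩
  let U : Finset (Fin n) := R ∪ Sᶜ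
  have hdisj : Disjoint R Sᶜ := Finset.disjoint_left.2 fun k hk hk' =>
    Finset.mem_compl.1 hk' (hRS hk)
  let L : K →ₗ[ℝ] (∀ k : U, LinearMap.range (siteProj K k)) :=
    LinearMap.pi fun k => (siteProj K k).rangeRestrict
  have hLk : ∀ X k (hk : k ∈ U), (L X ⟨k, hk⟩ : su2) = siteProj K k X := fun X k hk => rfl
  have hzero : ∀ X : K, (∀ k ∈ R, siteProj K k X = 0) → ∀ k ∈ S, siteProj K k X = 0 := by
    intro X hX k hk
    obtain ⟨r, hr, hrk⟩ := Finset.mem_image.1 (hRim ▸ Finset.mem_image_of_mem κ hk : κ k ∈ R.image κ)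
    exact LinearMap.mem_ker.1 (hrk ▸ LinearMap.mem_ker.2 (hX r hr) : X ∈ κ k)
  have hL : Function.Injective L := by
    refine (injective_iff_map_eq_zero L).2 fun X hX => ?_
    have hU : ∀ k ∈ U, siteProj K k X = 0 := fun k hk => by rw [← hLk X k hk, hX]; rfl
    refine Subtype.ext (eq_zero_of_snd_eq_zero hψ X.2 (funext fun k => ?_))
    by_cases hk : k ∈ S
    · exact hzero X (fun r hr => hU r (Finset.mem_union_left _ hr)) k hk
    · exact hU k (Finset.mem_union_right _ (Finset.mem_compl.2 hk))
  have hle := LinearMap.finrank_le_finrank_of_injective hL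
  have hsum : Module.finrank ℝ (∀ k : U, LinearMap.range (siteProj K k)) =
      3 * R.card + ∑ k ∈ Sᶜ, Module.finrank ℝ (LinearMap.range (siteProj K k)) := by
    rw [Module.finrank_pi_fintype,
      Finset.sum_coe_sort U (fun k => Module.finrank ℝ (LinearMap.range (siteProj K k))),
      Finset.sum_union hdisj, Finset.sum_const_nat (m := 3), mul_comm]
    intro k hk
    rw [(hS k).1 (hRS hk), finrank_top, finrank_su2]
  have hone : ∀ k ∈ Sᶜ, Module.finrank ℝ (LinearMap.range (siteProj K k)) ≤ 1 := fun k hk =>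
    finrank_range_siteProj_le_one fun h => Finset.mem_compl.1 hk ((hS k).2 h)
  have hcard := Finset.card_add_card_compl S
  rw [Fintype.card_fin] at hcard
  rcases Sᶜ.eq_empty_or_nonempty with hemp | ⟨k, hk⟩
  -- Here 4|R| ≤ n and dim K ≤ 3|R|; either `R` is empty or 3|R| ≤ n - |R| ≤ n - 1.
  · rw [hemp, Finset.card_empty] at hcard
    rw [hemp, Finset.sum_empty] at hsum
    omega
  -- The strict inequality gains the final -1. Either the rank at `k` is 0, or equality of
  -- dimensions would make `L` onto, and a preimage of a vector concentrated at `k` would be a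
  -- nonzero stabilizer element acting on one qubit.
  have hlt : Module.finrank ℝ K < 3 * R.card + Sᶜ.card := by
    by_cases hk0 : Module.finrank ℝ (LinearMap.range (siteProj K k)) = 0
    · have h := Finset.sum_lt_sum hone ⟨k, hk, by omega⟩
      simp only [Finset.sum_const, smul_eq_mul, mul_one] at h
      omega
    · have h := Finset.sum_le_sum hone
      simp only [Finset.sum_const, smul_eq_mul, mul_one] at h
      by_contra! hge
      have hLsurj := (LinearMap.injective_iff_surjective_of_finrank_eq_finrank
        (show Module.finrank ℝ K = _ by omega)).1 hL
      have hbot : LinearMap.range (siteProj K k) ≠ ⊥ := fun h0 => hk0 (by rw [h0, finrank_bot])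
      obtain ⟨A, hA, hA0⟩ := Submodule.exists_mem_ne_zero_of_ne_bot hbot
      have hkU : k ∈ U := Finset.mem_union_right _ hk
      obtain ⟨X, hX⟩ := hLsurj (Pi.single ⟨k, hkU⟩ ⟨A, hA⟩)
      have hXk : siteProj K k X = A := by rw [← hLk X k hkU, hX, Pi.single_eq_same]
      have hXi : ∀ i ∈ U, i ≠ k → siteProj K i X = 0 := fun i hi hik => by
        rw [← hLk X i hi, hX, Pi.single_eq_of_ne (by simpa using hik)]; rfl
      have hX0 : X.1 = 0 := by
        refine eq_zero_of_supported_on_site (by omega) hprod X.2 k fun i hik => ?_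
        by_cases hi : i ∈ S
        · exact hzero X (fun r hr => hXi r (Finset.mem_union_left _ hr) fun hrk =>
            Finset.mem_compl.1 hk (hrk ▸ hRS hr)) i hi
        · exact hXi i (Finset.mem_union_right _ (Finset.mem_compl.2 hi)) hik
      exact hA0 (by rw [← hXk, siteProj_apply, hX0]; rfl)
  omega

end QubitStab

end

theorem mainTheorem1 (n : ℕ) (ψ : QubitStab.QubitSpace (Fin n)) (hψ : ψ ≠ 0)
    (hprod : ¬ QubitStab.IsProduct ψ) :
    (n = 1 → Module.finrank ℝ (QubitStab.stabilizer ψ) ≤ 1) ∧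
    (n = 2 → Module.finrank ℝ (QubitStab.stabilizer ψ) ≤ 3) ∧
    (3 ≤ n → Module.finrank ℝ (QubitStab.stabilizer ψ) ≤ n - 1) := by
  refine ⟨?_, ?_, fun hn => QubitStab.finrank_stabilizer_of_three_le hn hψ hprod⟩
  · rintro rfl
    exact QubitStab.finrank_stabilizer_one hψ
  · rintro rfl
    exact QubitStab.finrank_stabilizer_two hprod
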